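/- Let $K$ be a field of characteristic zero, let $z=(z_1,\dots,z_n)$ and $\xi=(\xi_1,\dots,\xi_n)$ be commuting variables, and for $m\in\mathbb Z$ let $A_m\subset K[\xi,z]$ be the span of the monomials $\xi^\alpha z^\beta$ with $|\beta|-|\alpha|=m$. Let $\bar{\mathcal A}\subset K[[\xi,z]]$ be the algebra of all sums $u=\sum_{m\in\mathbb Z}u_m$ with $u_m\in A_m$ for all $m$ and $u_m=0$ for all sufficiently negative $m$. Let $\Lambda=\sum_{i=1}^n\partial_{\xi_i}\partial_{z_i}$. On $K[\xi,z]$, where $\Lambda$ is locally nilpotent, put $\Phi=e^\Lambda=\sum_{k\ge 0}\Lambda^k/k!$; this map preserves each $A_m$, and it is extended to $\bar{\mathcal A}$ by $\Phi\big(\sum_m u_m\big)=\sum_m\Phi(u_m)$. Let $H=(H_1,\dots,H_n)\in K[[z]]^n$ with every $H_i$ of order at least $2$, let $F(z)=z-H(z)$, and let $\mathcal JF=\det(\partial F_i/\partial z_j)$. Then there is exactly one $N\in K[[z]]^n$ such that $G(z)=z+N(z)$ has no constant terms and is the formal inverse of $F$, that is, $F(G(z))=z=G(F(z))$; every $N_i$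 has order at least $2$. Moreover, for every $q\in K[[z]]$, both $q(z)\,\mathcal JF(z)\,e^{\langle\xi,H(z)\rangle}$ and $q(G(z))\,e^{\langle\xi,N(z)\rangle}$ lie in $\bar{\mathcal A}$, and $$\Phi\Big(q(z)\,\mathcal JF(z)\,e^{\langle\xi,H(z)\rangle}\Big)=q(G(z))\,e^{\langle\xi,N(z)\rangle},$$ where $\langle\xi,H\rangle=\sum_{i=1}^n\xi_iH_i$ and $\langle\xi,N\rangle=\sum_{i=1}^n\xi_iN_i$. -/

import Mathlib

open scoped Nat

namespace PhaseSpace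

variable {K : Type*} [Field K] {n : ℕ}

/-- The weight of the variables of `K[ξ, z]`. The index `Sum.inl i` stands for `ξ_i`, which has
weight `-1`, and `Sum.inr i` stands for `z_i`, which has weight `1`. -/
def etaWeight (n : ℕ) : Fin n ⊕ Fin n → ℤ := Sum.elim (fun _ => -1) (fun _ => 1)

/-- The `η`-degree `|β| - |α|` of the monomial `ξ^α z^β` with exponent vector `d = (α, β)`. -/
noncomputable def eta (d : (Fin n ⊕ Fin n) →₀ ℕ) : ℤ := Finsupp.weight (etaWeight n) d

theorem eta_eq (d : (Fin n ⊕ Fin n) →₀ ℕ) :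
    eta d = (∑ i, (d (Sum.inr i) : ℤ)) - ∑ i, (d (Sum.inl i) : ℤ) := by
  rw [eta, Finsupp.weight_apply, Finsupp.sum_fintype _ _ (by simp)]
  simp [etaWeight, Fintype.sum_sum_type]
  ring

theorem eta_add (d e : (Fin n ⊕ Fin n) →₀ ℕ) : eta (d + e) = eta d + eta e := map_add _ d e

/-- The operator `Λ = ∑ i, ∂_{ξ_i} ∂_{z_i}` on the polynomial algebra `K[ξ, z]`. -/
noncomputable def Lam (K : Type*) [Field K] (n : ℕ) :
    Module.End K (MvPolynomial (Fin n ⊕ Fin n) K) :=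
  ∑ i : Fin n, (MvPolynomial.pderiv (R := K) (Sum.inl i)).toLinearMap ∘ₗ
    (MvPolynomial.pderiv (Sum.inr i)).toLinearMap

theorem Lam_apply (f : MvPolynomial (Fin n ⊕ Fin n) K) :
    Lam K n f = ∑ i : Fin n, MvPolynomial.pderiv (Sum.inl i) (MvPolynomial.pderiv (Sum.inr i) f) := by
  simp [Lam]

theorem coeff_Lam_pow_eq_zero (f : MvPolynomial (Fin n ⊕ Fin n) K) (N : ℕ)
    (hf : ∀ d, N ≤ d.degree → f.coeff d = 0) (m : ℕ) :
    ∀ d, N ≤ d.degree + m → ((Lam K n ^ m) f).coeff d = 0 := by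
  induction m with
  | zero => simpa using hf
  | succ m ih =>
    intro d hd
    rw [pow_succ', Module.End.mul_apply, Lam_apply, MvPolynomial.coeff_sum]
    refine Finset.sum_eq_zero fun i _ => ?_
    rw [MvPolynomial.coeff_pderiv, MvPolynomial.coeff_pderiv, ih]
    · simp
    · simp only [map_add, Finsupp.degree_single]
      omega

/-- `Λ` is locally nilpotent. -/
theorem Lam_pow_eq_zero (f : MvPolynomial (Fin n ⊕ Fin n) K) {m : ℕ} (hm : f.totalDegree < m) :
    (Lam K n ^ m) f = 0 := by
  ext d
  rw [coeff_Lam_pow_eq_zero f (f.totalDegree + 1) _ m d (by omega)]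
  · simp
  · intro e he
    refine MvPolynomial.coeff_eq_zero_of_totalDegree_lt ?_
    rw [← Finsupp.degree_apply]
    omega

theorem finite_support_exp_Lam (f : MvPolynomial (Fin n ⊕ Fin n) K) :
    (Function.support fun m : ℕ => ((m ! : K)⁻¹) • (Lam K n ^ m) f).Finite := by
  refine (Set.finite_Iic f.totalDegree).subset fun m hm => ?_
  by_contra h
  exact hm (by simp [Lam_pow_eq_zero f (not_le.mp h)])

/-- The linear map `Φ = e^Λ = ∑ m, Λ^m / m!` on the polynomial algebra `K[ξ, z]`. For each
polynomial only finitely many terms of the sum are nonzero. -/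
noncomputable def PhiPoly (K : Type*) [Field K] (n : ℕ) :
    Module.End K (MvPolynomial (Fin n ⊕ Fin n) K) where
  toFun f := ∑ᶠ m : ℕ, ((m ! : K)⁻¹) • (Lam K n ^ m) f
  map_add' f g := by
    rw [← finsum_add_distrib (finite_support_exp_Lam f) (finite_support_exp_Lam g)]
    simp
  map_smul' c f := by
    rw [RingHom.id_apply, smul_finsum' c (finite_support_exp_Lam f)]
    simp [smul_comm c]

theorem isWeightedHomogeneous_Lam {f : MvPolynomial (Fin n ⊕ Fin n) K} {m : ℤ}
    (hf : f.IsWeightedHomogeneous (etaWeight n) m) :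
    (Lam K n f).IsWeightedHomogeneous (etaWeight n) m := by
  rw [Lam_apply]
  refine Submodule.sum_mem (MvPolynomial.weightedHomogeneousSubmodule K (etaWeight n) m)
    fun i _ => ?_
  have h1 : (MvPolynomial.pderiv (Sum.inr i) f).IsWeightedHomogeneous (etaWeight n) (m - 1) :=
    hf.pderiv (by simp [etaWeight])
  exact h1.pderiv (by simp [etaWeight]; ring)

/-- `Φ` preserves the `η`-homogeneous components `A_m[ξ, z]`. -/
theorem isWeightedHomogeneous_PhiPoly {f : MvPolynomial (Fin n ⊕ Fin n) K} {m : ℤ}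
    (hf : f.IsWeightedHomogeneous (etaWeight n) m) :
    (PhiPoly K n f).IsWeightedHomogeneous (etaWeight n) m := by
  have h : ∀ k : ℕ, ((Lam K n ^ k) f).IsWeightedHomogeneous (etaWeight n) m := by
    intro k
    induction k with
    | zero => simpa using hf
    | succ k ih =>
      rw [pow_succ', Module.End.mul_apply]
      exact isWeightedHomogeneous_Lam ih
  change (∑ᶠ k : ℕ, ((k ! : K)⁻¹) • (Lam K n ^ k) f) ∈
    MvPolynomial.weightedHomogeneousSubmodule K (etaWeight n) m
  refine finsum_induction
    (fun g => g ∈ MvPolynomial.weightedHomogeneousSubmodule K (etaWeight n) m)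
    (Submodule.zero_mem _) (fun _ _ hx hy => Submodule.add_mem _ hx hy) fun k => ?_
  exact Submodule.smul_mem _ _ (h k)

/-- The completion of `K[ξ, z]` with respect to the `η`-grading, as a subalgebra of `K[[ξ, z]]`:
the sums `∑ m, u_m` over the integers in which each `u_m` is a polynomial that is homogeneous of
`η`-degree `m`, and `u_m = 0` when `m` is negative enough. -/
noncomputable def etaCompletion (K : Type*) [Field K] (n : ℕ) :
    Subalgebra K (MvPowerSeries (Fin n ⊕ Fin n) K) where
  carrier := {u | (∃ N : ℤ, ∀ d, eta d ≤ N → MvPowerSeries.coeff d u = 0) ∧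
    ∀ m : ℤ, {d | eta d = m ∧ MvPowerSeries.coeff d u ≠ 0}.Finite}
  add_mem' := by
    rintro u v ⟨⟨N, hN⟩, hu⟩ ⟨⟨M, hM⟩, hv⟩
    refine ⟨⟨min N M, fun d hd => ?_⟩, fun m => ((hu m).union (hv m)).subset ?_⟩
    · rw [map_add, hN d (hd.trans (min_le_left _ _)), hM d (hd.trans (min_le_right _ _)), add_zero]
    · rintro d ⟨hd, hne⟩
      by_cases h : MvPowerSeries.coeff d u = 0
      · exact Or.inr ⟨hd, fun h' => hne (by rw [map_add, h, h', add_zero])⟩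
      · exact Or.inl ⟨hd, h⟩
  mul_mem' := by
    classical
    rintro u v ⟨⟨N, hN⟩, hu⟩ ⟨⟨M, hM⟩, hv⟩
    have key : ∀ d, MvPowerSeries.coeff d (u * v) ≠ 0 → ∃ a b, a + b = d ∧
        MvPowerSeries.coeff a u ≠ 0 ∧ MvPowerSeries.coeff b v ≠ 0 := by
      intro d hd
      rw [MvPowerSeries.coeff_mul] at hd
      obtain ⟨p, hp, hne⟩ := Finset.exists_ne_zero_of_sum_ne_zero hd
      exact ⟨p.1, p.2, Finset.HasAntidiagonal.mem_antidiagonal.mp hp, left_ne_zero_of_mul hne,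
        right_ne_zero_of_mul hne⟩
    refine ⟨⟨N + M, fun d hd => ?_⟩, fun m => ?_⟩
    · by_contra hne
      obtain ⟨a, b, rfl, ha, hb⟩ := key d hne
      have h1 : N < eta a := not_le.mp fun h => ha (hN a h)
      have h2 : M < eta b := not_le.mp fun h => hb (hM b h)
      rw [eta_add] at hd
      omega
    · refine (((Set.finite_Icc N (m - M)).biUnion fun k _ =>
        Set.Finite.image2 (fun a b => a + b) (hu k) (hv (m - k)))).subset ?_
      rintro d ⟨hd, hne⟩
      obtain ⟨a, b, rfl, ha, hb⟩ := key d hne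
      have h1 : N < eta a := not_le.mp fun h => ha (hN a h)
      have h2 : M < eta b := not_le.mp fun h => hb (hM b h)
      rw [eta_add] at hd
      simp only [Set.mem_iUnion]
      exact ⟨eta a, ⟨by omega, by omega⟩, a, ⟨rfl, ha⟩, b, ⟨by omega, hb⟩, rfl⟩
  algebraMap_mem' := by
    classical
    intro r
    have h : ∀ d : (Fin n ⊕ Fin n) →₀ ℕ,
        MvPowerSeries.coeff d (algebraMap K (MvPowerSeries (Fin n ⊕ Fin n) K) r) ≠ 0 → d = 0 := by
      intro d hd
      by_contra h0
      exact hd (by simp [MvPowerSeries.algebraMap_apply, MvPowerSeries.coeff_C, h0])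
    refine ⟨⟨-1, fun d hd => ?_⟩, fun m => (Set.finite_singleton 0).subset fun d hd => h d hd.2⟩
    by_contra hne
    rw [h d hne, eta, map_zero] at hd
    omega

/-- The `η`-homogeneous part `u_m` of an element `u` of the completion, a polynomial. -/
noncomputable def homPart (m : ℤ) (u : etaCompletion K n) : MvPolynomial (Fin n ⊕ Fin n) K :=
  ∑ d ∈ (u.2.2 m).toFinset, MvPolynomial.monomial d (MvPowerSeries.coeff d u.1)

theorem coeff_homPart (m : ℤ) (u : etaCompletion K n) (d : (Fin n ⊕ Fin n) →₀ ℕ) :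
    (homPart m u).coeff d = if eta d = m then MvPowerSeries.coeff d u.1 else 0 := by
  classical
  simp only [homPart, MvPolynomial.coeff_sum, MvPolynomial.coeff_monomial, Finset.sum_ite_eq',
    Set.Finite.mem_toFinset, Set.mem_ofPred_eq]
  by_cases h : eta d = m <;> by_cases h' : MvPowerSeries.coeff d u.1 = 0 <;> simp [h, h']

theorem isWeightedHomogeneous_homPart (m : ℤ) (u : etaCompletion K n) :
    (homPart m u).IsWeightedHomogeneous (etaWeight n) m := by
  intro d hd
  by_contra h
  exact hd (by rw [coeff_homPart]; exact if_neg h)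

theorem homPart_add (m : ℤ) (u v : etaCompletion K n) :
    homPart m (u + v) = homPart m u + homPart m v := by
  ext d
  by_cases h : eta d = m <;> simp [coeff_homPart, h]

theorem homPart_smul (m : ℤ) (c : K) (u : etaCompletion K n) :
    homPart m (c • u) = c • homPart m u := by
  ext d
  by_cases h : eta d = m <;> simp [coeff_homPart, h]

/-- The extension of `Φ = e^Λ` to the completion: it sends `∑ m, u_m` to `∑ m, Φ (u_m)`.
As `Φ (u_m)` is homogeneous of `η`-degree `m`, the coefficient of the sum at a monomial of
`η`-degree `m` is that of `Φ (u_m)`. -/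
noncomputable def Phi (K : Type*) [Field K] (n : ℕ) : Module.End K (etaCompletion K n) where
  toFun u := ⟨fun d => (PhiPoly K n (homPart (eta d) u)).coeff d, by
    obtain ⟨N, hN⟩ := u.2.1
    refine ⟨⟨N, fun d hd => ?_⟩, fun m => ?_⟩
    · have h0 : homPart (eta d) u = 0 := by
        ext e
        rw [coeff_homPart]
        split_ifs with h
        · simpa using hN e (h ▸ hd)
        · simp
      change (PhiPoly K n (homPart (eta d) u)).coeff d = 0
      simp [h0]
    · refine (PhiPoly K n (homPart m u)).support.finite_toSet.subset ?_
      rintro d ⟨rfl, hne⟩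
      exact MvPolynomial.mem_support_iff.mpr hne⟩
  map_add' u v := by
    ext d
    change (PhiPoly K n (homPart (eta d) (u + v))).coeff d =
      (PhiPoly K n (homPart (eta d) u)).coeff d + (PhiPoly K n (homPart (eta d) v)).coeff d
    rw [homPart_add, map_add, MvPolynomial.coeff_add]
  map_smul' c u := by
    ext d
    change (PhiPoly K n (homPart (eta d) (c • u))).coeff d =
      c * (PhiPoly K n (homPart (eta d) u)).coeff d
    rw [homPart_smul, map_smul, MvPolynomial.coeff_smul, smul_eq_mul]

/-- The `η`-homogeneous parts of `Φ u` are the images of those of `u`. -/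
theorem homPart_Phi (m : ℤ) (u : etaCompletion K n) :
    homPart m (Phi K n u) = PhiPoly K n (homPart m u) := by
  ext d
  rw [coeff_homPart]
  split_ifs with h
  · subst h
    rfl
  · by_contra hne
    exact h (isWeightedHomogeneous_PhiPoly (isWeightedHomogeneous_homPart m u) (Ne.symm hne))

/-- `G` is the inverse of `F` under composition of formal maps without constant terms:
`F(G(z)) = z` and `G(F(z)) = z`. -/
def IsFormalInverse (F G : Fin n → MvPowerSeries (Fin n) K) : Prop :=
  (∀ i, MvPowerSeries.constantCoeff (F i) = 0) ∧ (∀ i, MvPowerSeries.constantCoeff (G i) = 0) ∧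
  (∀ i, MvPowerSeries.subst G (F i) = MvPowerSeries.X i) ∧
  (∀ i, MvPowerSeries.subst F (G i) = MvPowerSeries.X i)

/-- The Jacobian `𝒥F = det (∂_j F_i)`. -/
noncomputable def jacobian (F : Fin n → MvPowerSeries (Fin n) K) : MvPowerSeries (Fin n) K :=
  Matrix.det (Matrix.of fun i j => MvPowerSeries.pderiv K j (F i))

/-- A power series in `z`, viewed as a power series in `(ξ, z)`. -/
noncomputable def inZ (f : MvPowerSeries (Fin n) K) : MvPowerSeries (Fin n ⊕ Fin n) K :=
  MvPowerSeries.rename Sum.inr f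

/-- The pairing `⟨ξ, H(z)⟩ = ∑ i, ξ_i H_i(z)`. -/
noncomputable def pairing (H : Fin n → MvPowerSeries (Fin n) K) :
    MvPowerSeries (Fin n ⊕ Fin n) K :=
  ∑ i, MvPowerSeries.X (Sum.inl i) * inZ (H i)

/-- The formal exponential `e^{⟨ξ, H(z)⟩}`. -/
noncomputable def expPairing [CharZero K] (H : Fin n → MvPowerSeries (Fin n) K) :
    MvPowerSeries (Fin n ⊕ Fin n) K :=
  (PowerSeries.exp K).subst (pairing H)

end PhaseSpace

/-!
Write `F = z - H`, let `G = z + N` be its inverse, and put `T(u) = Φ (u(z) e^{⟨ξ, H⟩})`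
(`phiExp`). The formula to prove is `T(q 𝒥F) = q(G) e^{⟨ξ, N⟩}`.

The operator `Φ = e^Λ` commutes with all partial derivatives and satisfies
`Φ ∘ z_i = (z_i + ∂_{ξ_i}) ∘ Φ` and `Φ ∘ ξ_i = (ξ_i + ∂_{z_i}) ∘ Φ` (`Phi_pderivC`, `Phi_XC_mul`).
As `∂_{ξ_i}` multiplies `e^{⟨ξ, H⟩}` by `H_i`, the first relation reads `T(F_i u) = z_i T(u)`.
Hence `T(p(F) u) = p(z) T(u)` for polynomials `p`, and for power series by continuity with respect
to the `η`-filtration (`phiExp_subst_mul`). With `p = q(G)`, so that `p(F) = q`, this gives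
`T(q 𝒥F) = q(G) T(𝒥F)`, and it remains to show `T(𝒥F) = e^{⟨ξ, N⟩}` (`phiExp_jacobian`).

Both sides are solutions `w` of `∂_{ξ_i} w = N_i w`, because `∂_{ξ_i} T(u) = T(H_i u)` and
`H_i = N_i(F)`, and have constant term `1`. So they agree once `∂_{z_k} w` vanishes at `ξ = 0` for
both (`eq_zero_of_pderiv`). For `T(𝒥F)` this follows from
`(∂_{z_k} + ξ_k) T(𝒥F) = ∑ j, ξ_j T(adj(DF)_{jk})` (`pderivC_inr_phiExp_jacobian`), which is the
second commutation relation combined with the Piola identity `∑ i, ∂_i adj(DF)_{ik} = 0`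
(`Derivation.sum_adjugate_eq_zero`).

The inverse exists because `q ↦ q(F)` differs from the identity by an operator that raises the
order, and is therefore bijective (`MvPowerSeries.exists_inverse`). All series involved lie in the
completion since `e^{⟨ξ, H⟩}` only contains monomials `ξ^α z^β` with `2 |α| ≤ |β|` (`tame`).
-/

/-! ### Inverses of formal maps tangent to the identity -/

namespace MvPowerSeries

variable {σ K : Type*} [Field K]

theorem inverse_unique {F G G' : σ → MvPowerSeries σ K} (hF : HasSubst F) (hG : HasSubst G)
    (h : ∀ i, subst G (F i) = X i) (h' : ∀ i, subst F (G' i) = X i) : G' = G := by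
  funext i
  have h1 := subst_comp_subst_apply hF hG (G' i)
  rw [h', subst_X hG, funext h, subst_self] at h1
  exact h1.symm

variable [Finite σ]

theorem hasSubst_of_two_le_order_sub_X {F : σ → MvPowerSeries σ K}
    (hF : ∀ i, 2 ≤ (F i - X i).order) : HasSubst F := by
  refine hasSubst_of_constantCoeff_zero fun i => ?_
  have h : coeff 0 (F i - X i) = 0 :=
    coeff_of_lt_order (lt_of_lt_of_le (by simp) (hF i))
  simpa using h

/-- A map tangent to the identity changes a monomial only in higher degrees. -/
theorem degree_succ_le_order_subst_monomial_sub {F : σ → MvPowerSeries σ K}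
    (hF : ∀ i, 2 ≤ (F i - X i).order) (m : ℕ) (d : σ →₀ ℕ) (hd : d.degree = m) :
    ((m + 1 : ℕ) : ℕ∞) ≤ (subst F (monomial d (1 : K)) - monomial d (1 : K)).order := by
  classical
  have hs := hasSubst_of_two_le_order_sub_X hF
  induction m generalizing d with
  | zero =>
    obtain rfl : d = 0 := by simpa [Finsupp.degree_eq_zero_iff] using hd
    have h1 : subst F (1 : MvPowerSeries σ K) = 1 := by rw [← coe_substAlgHom hs, map_one]
    simp [h1]
  | succ m ih =>
    obtain ⟨i, hi⟩ : ∃ i, d i ≠ 0 := by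
      by_contra! h
      have : d = 0 := Finsupp.ext h
      simp [this] at hd
    obtain ⟨e, rfl⟩ : ∃ e, d = e + Finsupp.single i 1 :=
      ⟨d - Finsupp.single i 1,
        (tsub_add_cancel_of_le (by simpa using Nat.one_le_iff_ne_zero.mpr hi)).symm⟩
    have he : e.degree = m := by simpa using hd
    have hmon : monomial (e + Finsupp.single i 1) (1 : K) = monomial e 1 * X i := by
      rw [X_def, monomial_mul_monomial, one_mul]
    have hsplit : subst F (monomial (e + Finsupp.single i 1) (1 : K)) -
        monomial (e + Finsupp.single i 1) (1 : K) =
        (subst F (monomial e (1 : K)) - monomial e 1) * F i +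
          monomial e (1 : K) * (F i - X i) := by
      rw [hmon, subst_mul hs, subst_X hs]
      ring
    have hFi : (1 : ℕ∞) ≤ (F i).order := by
      rw [one_le_order_iff_constCoeff_eq_zero]
      have h : coeff 0 (F i - X i) = 0 :=
        coeff_of_lt_order (lt_of_lt_of_le (by simp) (hF i))
      simpa using h
    have hmo : (m : ℕ∞) ≤ (monomial e (1 : K)).order := by
      rw [order_monomial_of_ne_zero one_ne_zero, he]
    rw [hsplit]
    refine le_trans (le_min ?_ ?_) min_order_le_add
    · refine le_trans ?_ le_order_mul
      push_cast
      exact_mod_cast add_le_add (ih e he) hFi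
    · refine le_trans ?_ le_order_mul
      push_cast
      have := add_le_add hmo (hF i)
      rwa [add_assoc, one_add_one_eq_two]

/-- Substitution of a map tangent to the identity is unipotent for the filtration by order. -/
theorem succ_le_order_sub_subst {F : σ → MvPowerSeries σ K}
    (hF : ∀ i, 2 ≤ (F i - X i).order) {q : MvPowerSeries σ K} {m : ℕ} (hq : (m : ℕ∞) ≤ q.order) :
    ((m + 1 : ℕ) : ℕ∞) ≤ (q - subst F q).order := by
  classical
  have hs := hasSubst_of_two_le_order_sub_X hF
  refine nat_le_order fun e he => ?_
  have key : ∀ d, coeff d q • coeff e (d.prod fun s k => F s ^ k) =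
      if d = e then coeff d q else 0 := by
    intro d
    rcases lt_or_ge d.degree m with hd | hd
    · have h0 : coeff d q = 0 := coeff_of_lt_order (lt_of_lt_of_le (by exact_mod_cast hd) hq)
      simp [h0]
    · have h1 := degree_succ_le_order_subst_monomial_sub hF d.degree d rfl
      have h2 : coeff e (subst F (monomial d (1 : K)) - monomial d (1 : K)) = 0 :=
        coeff_of_lt_order
          (lt_of_lt_of_le (by exact_mod_cast (by omega : e.degree < d.degree + 1)) h1)
      rw [subst_monomial hs, map_sub, map_one, one_mul, sub_eq_zero, coeff_monomial] at h2
      rw [h2]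
      simp [eq_comm]
  rw [map_sub, coeff_subst hs, finsum_congr key, finsum_eq_single _ e (by simp +contextual)]
  simp

theorem le_order_subst_of_le_order {F : σ → MvPowerSeries σ K}
    (hF : ∀ i, 2 ≤ (F i - X i).order) {q : MvPowerSeries σ K} {m : ℕ} (hq : (m : ℕ∞) ≤ q.order) :
    (m : ℕ∞) ≤ (subst F q).order := by
  have h : subst F q = q + -(q - subst F q) := by ring
  rw [h]
  refine le_trans (le_min hq ?_) min_order_le_add
  rw [order_neg]
  exact le_trans (by simp) (succ_le_order_sub_subst hF hq)

/-- Inversion of a unipotent substitution by its Neumann series. -/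
theorem exists_subst_eq {F : σ → MvPowerSeries σ K} (hF : ∀ i, 2 ≤ (F i - X i).order)
    (q : MvPowerSeries σ K) : ∃ p : MvPowerSeries σ K, subst F p = q := by
  have hs := hasSubst_of_two_le_order_sub_X hF
  let L : ℕ → MvPowerSeries σ K := fun k => (fun p => p - subst F p)^[k] q
  have hLs : ∀ k, L (k + 1) = L k - subst F (L k) := fun k =>
    Function.iterate_succ_apply' (fun p : MvPowerSeries σ K => p - subst F p) k q
  have hL : ∀ k : ℕ, (k : ℕ∞) ≤ (L k).order := by
    intro k
    induction k with
    | zero => simp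
    | succ k ih =>
      rw [hLs]
      exact succ_le_order_sub_subst hF ih
  let p : MvPowerSeries σ K := fun d => ∑ k ∈ Finset.range (d.degree + 1), coeff d (L k)
  have hp : ∀ d, coeff d p = ∑ k ∈ Finset.range (d.degree + 1), coeff d (L k) := fun d => rfl
  have hpm : ∀ m : ℕ, (m : ℕ∞) ≤ (p - ∑ k ∈ Finset.range m, L k).order := by
    intro m
    refine nat_le_order fun d hd => ?_
    rw [map_sub, hp, map_sum, sub_eq_zero]
    refine Finset.sum_subset (Finset.range_mono (by omega)) fun k _ hk => ?_
    refine coeff_of_lt_order (lt_of_lt_of_le ?_ (hL k))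
    simp only [Finset.mem_range, not_lt] at hk
    exact_mod_cast (by omega : d.degree < k)
  have htel : ∀ m, subst F (∑ k ∈ Finset.range m, L k) = q - L m := by
    intro m
    induction m with
    | zero => rw [Finset.sum_range_zero, ← coe_substAlgHom hs, map_zero]; simp [L]
    | succ m ih =>
      rw [Finset.sum_range_succ, subst_add hs, ih, hLs]
      ring
  refine ⟨p, ?_⟩
  ext d
  have h1 := le_order_subst_of_le_order hF (hpm (d.degree + 1))
  have h2 : coeff d (subst F (p - ∑ k ∈ Finset.range (d.degree + 1), L k)) = 0 :=
    coeff_of_lt_order (lt_of_lt_of_le (by exact_mod_cast Nat.lt_succ_self _) h1)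
  have h3 : coeff d (L (d.degree + 1)) = 0 :=
    coeff_of_lt_order (lt_of_lt_of_le (by exact_mod_cast Nat.lt_succ_self _) (hL _))
  rw [subst_sub hs, htel, map_sub, map_sub, h3, sub_zero, sub_eq_zero] at h2
  exact h2

/-- `G_i` is the preimage of `X i` under substitution of `F`. Since `G_i - X i = G_i - G_i(F)` and
this difference has larger order than `G_i`, the map `G` is again tangent to the identity. -/
theorem exists_left_inverse {F : σ → MvPowerSeries σ K} (hF : ∀ i, 2 ≤ (F i - X i).order) :
    ∃ G : σ → MvPowerSeries σ K, (∀ i, 2 ≤ (G i - X i).order) ∧ ∀ i, subst F (G i) = X i := by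
  choose G hG using fun i => exists_subst_eq hF (X i)
  refine ⟨G, fun i => ?_, hG⟩
  have h0 : ((1 : ℕ) : ℕ∞) ≤ (G i - subst F (G i)).order :=
    le_trans (by simp) (succ_le_order_sub_subst hF (q := G i) (m := 0) (by simp))
  have h1 : ((1 : ℕ) : ℕ∞) ≤ (G i).order := by
    rw [hG, Nat.cast_one, one_le_order_iff_constCoeff_eq_zero] at h0
    rw [Nat.cast_one, one_le_order_iff_constCoeff_eq_zero]
    simpa using h0
  have h2 := succ_le_order_sub_subst hF h1
  rwa [hG] at h2

theorem exists_inverse {F : σ → MvPowerSeries σ K} (hF : ∀ i, 2 ≤ (F i - X i).order) :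
    ∃ G : σ → MvPowerSeries σ K, (∀ i, 2 ≤ (G i - X i).order) ∧
      (∀ i, subst F (G i) = X i) ∧ ∀ i, subst G (F i) = X i := by
  obtain ⟨G, hG, hGF⟩ := exists_left_inverse hF
  obtain ⟨F', -, hFG⟩ := exists_left_inverse hG
  have hs := hasSubst_of_two_le_order_sub_X hF
  have hsG := hasSubst_of_two_le_order_sub_X hG
  -- A left inverse `F'` of `G` agrees with `F`, by associativity of substitution.
  have hFF : ∀ i, F' i = F i := by
    intro i
    have h := subst_comp_subst_apply hsG hs (F' i)
    rw [hFG, subst_X hs, funext hGF, subst_self] at h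
    exact h.symm
  exact ⟨G, hG, hGF, fun i => hFF i ▸ hFG i⟩

end MvPowerSeries

/-! ### Jacobi's formula and the Piola identity -/

section Jacobi

variable {ι K A : Type*} [DecidableEq ι] [CommRing K] [CommRing A] [Algebra K A]

theorem Derivation.leibniz_finset_prod (D : Derivation K A A) (s : Finset ι) (f : ι → A) :
    D (∏ i ∈ s, f i) = ∑ i ∈ s, (∏ j ∈ s.erase i, f j) * D (f i) := by
  induction s using Finset.induction_on with
  | empty => simp
  | insert a s ha ih =>
    rw [Finset.prod_insert ha, D.leibniz, ih, Finset.sum_insert ha, Finset.erase_insert ha,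
      smul_eq_mul, smul_eq_mul, Finset.mul_sum, add_comm]
    congr 1
    refine Finset.sum_congr rfl fun i hi => ?_
    rw [Finset.erase_insert_of_ne (by rintro rfl; exact ha hi),
      Finset.prod_insert (by simp [ha]), mul_assoc]

variable [Fintype ι]

/-- Jacobi's formula: `D (det A) = tr (adj A * D A)`. -/
theorem Derivation.det_eq_sum_adjugate (D : Derivation K A A) (M : Matrix ι ι A) :
    D M.det = ∑ i, ∑ j, M.adjugate i j * D (M j i) := by
  have h1 : ∀ i, ∑ j, M.adjugate i j * D (M j i) = (M.updateCol i fun j => D (M j i)).det := by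
    intro i
    rw [← Matrix.cramer_apply, Matrix.cramer_eq_adjugate_mulVec]
    rfl
  simp_rw [h1, Matrix.det_apply, map_sum]
  rw [Finset.sum_comm]
  refine Finset.sum_congr rfl fun σ _ => ?_
  rw [← Finset.smul_sum, Units.smul_def, Units.smul_def, map_zsmul, D.leibniz_finset_prod]
  congr 1
  refine Finset.sum_congr rfl fun i _ => ?_
  rw [← Finset.prod_erase_mul _ _ (Finset.mem_univ i)]
  congr 1
  · refine Finset.prod_congr rfl fun j hj => ?_
    rw [Matrix.updateCol_ne (Finset.ne_of_mem_erase hj)]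
  · simp

/-- The Piola identity: the columns of the cofactor matrix of an invertible Jacobian matrix are
divergence free. Writing `adj J = det J • J⁻¹`, it follows from Jacobi's formula,
`D J⁻¹ = -J⁻¹ (D J) J⁻¹` and the symmetry of second derivatives. -/
theorem Derivation.sum_adjugate_eq_zero (D : ι → Derivation K A A)
    (hD : ∀ i j a, D i (D j a) = D j (D i a)) (f : ι → A)
    (hdet : IsUnit (Matrix.of fun i j => D j (f i)).det) (k : ι) :
    ∑ i, D i ((Matrix.of fun i j => D j (f i)).adjugate i k) = 0 := by
  set J : Matrix ι ι A := Matrix.of fun i j => D j (f i) with hJ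
  have hJa : ∀ i j, J i j = D j (f i) := fun _ _ => rfl
  obtain ⟨B, hJB, hBJ⟩ : ∃ B : Matrix ι ι A, J * B = 1 ∧ B * J = 1 :=
    ⟨J⁻¹, Matrix.mul_nonsing_inv J hdet, Matrix.nonsing_inv_mul J hdet⟩
  have hadj : J.adjugate = J.det • B := by
    calc J.adjugate = J.adjugate * (J * B) := by rw [hJB, mul_one]
      _ = J.det • B := by rw [← mul_assoc, Matrix.adjugate_mul, Matrix.smul_mul, one_mul]
  -- the derivative of the inverse matrix
  have hDB : ∀ l i j, D l (B i j) = -∑ a, ∑ b, B i a * D l (J a b) * B b j := by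
    intro l i j
    have h0 : ∀ a, ∑ b, (J a b * D l (B b j) + B b j * D l (J a b)) = 0 := by
      intro a
      have h : D l ((J * B) a j) = 0 := by
        rw [hJB, Matrix.one_apply]
        split_ifs <;> simp
      rw [Matrix.mul_apply, map_sum] at h
      simpa [Derivation.leibniz] using h
    have h1 : ∑ a, B i a * ∑ b, J a b * D l (B b j) = D l (B i j) := by
      simp_rw [Finset.mul_sum]
      rw [Finset.sum_comm]
      simp_rw [← mul_assoc, ← Finset.sum_mul, ← Matrix.mul_apply, hBJ, Matrix.one_apply]
      simp
    rw [← h1, ← Finset.sum_neg_distrib]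
    refine Finset.sum_congr rfl fun a _ => ?_
    have h2 := h0 a
    rw [Finset.sum_add_distrib, add_eq_zero_iff_eq_neg] at h2
    rw [h2, mul_neg, Finset.mul_sum]
    congr 1
    refine Finset.sum_congr rfl fun b _ => ?_
    ring
  have hsym : ∀ l a b, D l (J a b) = D b (J a l) := fun l a b => hD l b (f a)
  have hterm : ∀ i, D i (J.adjugate i k) =
      J.det * (∑ a, ∑ b, B i k * (B a b * D i (J b a)) -
        ∑ a, ∑ b, B i a * D i (J a b) * B b k) := by
    intro i
    rw [hadj, Matrix.smul_apply, smul_eq_mul, Derivation.leibniz, hDB,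
      Derivation.det_eq_sum_adjugate, hadj]
    simp only [Matrix.smul_apply, smul_eq_mul, mul_neg, mul_sub, Finset.mul_sum]
    rw [neg_add_eq_sub]
    congr 1
    refine Finset.sum_congr rfl fun a _ => Finset.sum_congr rfl fun b _ => ?_
    ring
  simp_rw [hterm]
  rw [← Finset.mul_sum, Finset.sum_sub_distrib]
  have hcomm : ∑ i, ∑ a, ∑ b, B i k * (B a b * D i (J b a)) =
      ∑ i, ∑ a, ∑ b, B i a * D i (J a b) * B b k := by
    calc ∑ i, ∑ a, ∑ b, B i k * (B a b * D i (J b a))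
        = ∑ a, ∑ i, ∑ b, B i k * (B a b * D i (J b a)) := Finset.sum_comm
      _ = ∑ a, ∑ b, ∑ i, B i k * (B a b * D i (J b a)) :=
          Finset.sum_congr rfl fun a _ => Finset.sum_comm
      _ = _ := by
          refine Finset.sum_congr rfl fun a _ => Finset.sum_congr rfl fun b _ =>
            Finset.sum_congr rfl fun i _ => ?_
          rw [hsym i b a]
          ring
  rw [hcomm, sub_self, mul_zero]

end Jacobi

/-! ### The commutation relations of `Φ` -/

namespace PhaseSpace

variable {K : Type*} [Field K] {n : ℕ}

theorem pderiv_comm_poly {σ : Type*} (s t : σ) (f : MvPolynomial σ K) :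
    MvPolynomial.pderiv s (MvPolynomial.pderiv t f) =
      MvPolynomial.pderiv t (MvPolynomial.pderiv s f) := by
  classical
  ext d
  simp only [MvPolynomial.coeff_pderiv, Finsupp.add_apply, Finsupp.single_apply]
  rw [add_right_comm]
  by_cases h : s = t
  · subst h; rfl
  · simp only [h, Ne.symm h, if_false]
    push_cast
    ring

theorem pderiv_comm {σ : Type*} (s t : σ) (f : MvPowerSeries σ K) :
    MvPowerSeries.pderiv K s (MvPowerSeries.pderiv K t f) =
      MvPowerSeries.pderiv K t (MvPowerSeries.pderiv K s f) := by
  classical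
  ext d
  simp only [MvPowerSeries.coeff_pderiv, Finsupp.add_apply, Finsupp.single_apply]
  rw [add_right_comm]
  by_cases h : s = t
  · subst h; rfl
  · simp only [h, Ne.symm h, if_false]
    push_cast
    ring

theorem Lam_pderiv (s : Fin n ⊕ Fin n) (f : MvPolynomial (Fin n ⊕ Fin n) K) :
    Lam K n (MvPolynomial.pderiv s f) = MvPolynomial.pderiv s (Lam K n f) := by
  simp only [Lam_apply, map_sum]
  refine Finset.sum_congr rfl fun i _ => ?_
  rw [pderiv_comm_poly (Sum.inr i) s, pderiv_comm_poly (Sum.inl i) s]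

/-- The commutator of `Λ` with a variable is the derivative in the conjugate variable; `Sum.swap`
exchanges the indices of `ξ_i` and `z_i`. -/
theorem Lam_X_mul (s : Fin n ⊕ Fin n) (f : MvPolynomial (Fin n ⊕ Fin n) K) :
    Lam K n (MvPolynomial.X s * f) =
      MvPolynomial.X s * Lam K n f + MvPolynomial.pderiv s.swap f := by
  classical
  have h : ∀ i : Fin n, MvPolynomial.pderiv (Sum.inl i)
      (MvPolynomial.pderiv (Sum.inr i) (MvPolynomial.X s * f)) =
      MvPolynomial.X s * MvPolynomial.pderiv (Sum.inl i) (MvPolynomial.pderiv (Sum.inr i) f) +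
        if s = Sum.inr i ∨ s = Sum.inl i then MvPolynomial.pderiv s.swap f else 0 := by
    intro i
    rcases s with j | j <;> by_cases hij : j = i
    · subst hij
      simp [MvPolynomial.pderiv_X]
    · simp [MvPolynomial.pderiv_X, hij]
    · subst hij
      simp [MvPolynomial.pderiv_X]
    · simp [MvPolynomial.pderiv_X, hij]
  rw [Lam_apply, Finset.sum_congr rfl fun i _ => h i, Finset.sum_add_distrib, ← Finset.mul_sum,
    Lam_apply]
  congr 1
  rcases s with j | j <;> simp

theorem Lam_pow_pderiv (s : Fin n ⊕ Fin n) (m : ℕ) (f : MvPolynomial (Fin n ⊕ Fin n) K) :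
    (Lam K n ^ m) (MvPolynomial.pderiv s f) = MvPolynomial.pderiv s ((Lam K n ^ m) f) := by
  induction m with
  | zero => rfl
  | succ m ih => rw [pow_succ', Module.End.mul_apply, ih, Lam_pderiv, Module.End.mul_apply]

theorem Lam_pow_succ_X_mul (s : Fin n ⊕ Fin n) (m : ℕ) (f : MvPolynomial (Fin n ⊕ Fin n) K) :
    (Lam K n ^ (m + 1)) (MvPolynomial.X s * f) = MvPolynomial.X s * (Lam K n ^ (m + 1)) f +
      ((m + 1 : ℕ) : K) • (Lam K n ^ m) (MvPolynomial.pderiv s.swap f) := by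
  induction m with
  | zero => simp [Lam_X_mul]
  | succ m ih =>
    rw [pow_succ', Module.End.mul_apply, ih, map_add, Lam_X_mul, map_smul,
      ← Module.End.mul_apply, ← pow_succ', ← Module.End.mul_apply, ← pow_succ', ← Lam_pow_pderiv,
      add_assoc]
    congr 1
    rw [Nat.cast_succ (m + 1), add_smul, one_smul, add_comm]

theorem PhiPoly_eq_sum (f : MvPolynomial (Fin n ⊕ Fin n) K) {M : ℕ} (hM : f.totalDegree < M) :
    PhiPoly K n f = ∑ m ∈ Finset.range M, ((m ! : K)⁻¹) • (Lam K n ^ m) f := by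
  change ∑ᶠ m : ℕ, ((m ! : K)⁻¹) • (Lam K n ^ m) f = _
  refine finsum_eq_sum_of_support_subset _ fun m hm => ?_
  by_contra h
  refine hm ?_
  simp only [Finset.coe_range, Set.mem_Iio, not_lt] at h
  simp [Lam_pow_eq_zero f (lt_of_lt_of_le hM h)]

theorem PhiPoly_one : PhiPoly K n 1 = 1 := by
  rw [PhiPoly_eq_sum 1 (M := 1) (by simp)]
  simp

theorem PhiPoly_pderiv (s : Fin n ⊕ Fin n) (f : MvPolynomial (Fin n ⊕ Fin n) K) :
    PhiPoly K n (MvPolynomial.pderiv s f) = MvPolynomial.pderiv s (PhiPoly K n f) := by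
  set M := max f.totalDegree (MvPolynomial.pderiv s f).totalDegree + 1
  rw [PhiPoly_eq_sum f (M := M) (by omega), PhiPoly_eq_sum _ (M := M) (by omega), map_sum]
  refine Finset.sum_congr rfl fun m _ => ?_
  rw [Lam_pow_pderiv, Derivation.map_smul]

theorem PhiPoly_X_mul [CharZero K] (s : Fin n ⊕ Fin n) (f : MvPolynomial (Fin n ⊕ Fin n) K) :
    PhiPoly K n (MvPolynomial.X s * f) =
      MvPolynomial.X s * PhiPoly K n f + PhiPoly K n (MvPolynomial.pderiv s.swap f) := by
  set M := max (max f.totalDegree (MvPolynomial.pderiv s.swap f).totalDegree)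
    (MvPolynomial.X s * f).totalDegree + 1
  rw [PhiPoly_eq_sum (MvPolynomial.X s * f) (M := M + 1) (by omega),
    PhiPoly_eq_sum f (M := M + 1) (by omega),
    PhiPoly_eq_sum (MvPolynomial.pderiv s.swap f) (M := M) (by omega),
    Finset.sum_range_succ', Finset.sum_range_succ' _ M, mul_add, Finset.mul_sum]
  have h : ∀ m : ℕ, (((m + 1) ! : K)⁻¹) • (Lam K n ^ (m + 1)) (MvPolynomial.X s * f) =
      MvPolynomial.X s * ((((m + 1) ! : K)⁻¹) • (Lam K n ^ (m + 1)) f) +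
        ((m ! : K)⁻¹) • (Lam K n ^ m) (MvPolynomial.pderiv s.swap f) := by
    intro m
    rw [Lam_pow_succ_X_mul, smul_add, smul_smul, mul_smul_comm]
    congr 2
    have h1 : ((m + 1 : ℕ) : K) ≠ 0 := Nat.cast_ne_zero.mpr m.succ_ne_zero
    rw [Nat.factorial_succ, Nat.cast_mul, mul_inv, mul_right_comm, inv_mul_cancel₀ h1, one_mul]
  simp_rw [h]
  rw [Finset.sum_add_distrib]
  simp
  ring

theorem etaWeight_swap (s : Fin n ⊕ Fin n) : etaWeight n s.swap = -etaWeight n s := by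
  rcases s with i | i <;> simp [etaWeight]

theorem eta_single (s : Fin n ⊕ Fin n) : eta (Finsupp.single s 1) = etaWeight n s := by
  simp [eta, Finsupp.weight_single]

theorem etaCompletion_ext {u v : etaCompletion K n} (h : ∀ m, homPart m u = homPart m v) :
    u = v := by
  ext d
  have h1 := congrArg (MvPolynomial.coeff d) (h (eta d))
  simpa [coeff_homPart] using h1

/-- The variables `ξ_i` and `z_i` as elements of the completion. -/
noncomputable def XC (s : Fin n ⊕ Fin n) : etaCompletion K n :=
  ⟨MvPowerSeries.X s, by
    classical
    have h : ∀ d, MvPowerSeries.coeff d (MvPowerSeries.X s : MvPowerSeries (Fin n ⊕ Fin n) K) ≠ 0 →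
        d = Finsupp.single s 1 := by
      intro d hd
      by_contra h0
      exact hd (by rw [MvPowerSeries.coeff_X, if_neg h0])
    refine ⟨⟨-2, fun d hd => ?_⟩, fun m => (Set.finite_singleton _).subset fun d hd => h d hd.2⟩
    by_contra hne
    rw [h d hne, eta_single] at hd
    rcases s with i | i <;> simp [etaWeight] at hd⟩

/-- The partial derivative with respect to `ξ_i` or `z_i`, as an operator on the completion. -/
noncomputable def pderivC (s : Fin n ⊕ Fin n) : Module.End K (etaCompletion K n) where
  toFun u := ⟨MvPowerSeries.pderiv K s u.1, by
    obtain ⟨N, hN⟩ := u.2.1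
    refine ⟨⟨N - etaWeight n s, fun d hd => ?_⟩, fun m => ?_⟩
    · rw [MvPowerSeries.coeff_pderiv, hN, zero_mul]
      rw [eta_add, eta_single]
      omega
    · refine Set.Finite.of_finite_image (f := fun d => d + Finsupp.single s 1)
        ((u.2.2 (m + etaWeight n s)).subset ?_) (add_left_injective _).injOn
      rintro _ ⟨d, ⟨hd, hne⟩, rfl⟩
      refine ⟨by simp only [eta_add, eta_single, hd], fun h => hne ?_⟩
      rw [MvPowerSeries.coeff_pderiv, h, zero_mul]⟩
  map_add' u v := Subtype.ext (map_add (MvPowerSeries.pderiv K s) u.1 v.1)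
  map_smul' c u := Subtype.ext (Derivation.map_smul (MvPowerSeries.pderiv K s) c u.1)

@[simp] theorem coe_XC (s : Fin n ⊕ Fin n) :
    ((XC s : etaCompletion K n) : MvPowerSeries (Fin n ⊕ Fin n) K) = MvPowerSeries.X s := rfl

@[simp] theorem coe_pderivC (s : Fin n ⊕ Fin n) (u : etaCompletion K n) :
    (pderivC s u : MvPowerSeries (Fin n ⊕ Fin n) K) = MvPowerSeries.pderiv K s u.1 := rfl

theorem coeff_X_mul_eq_zero {σ : Type*} (s : σ) (d : σ →₀ ℕ) (hd : d s = 0)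
    (f : MvPowerSeries σ K) : MvPowerSeries.coeff d (MvPowerSeries.X s * f) = 0 := by
  classical
  rw [MvPowerSeries.X_def, MvPowerSeries.coeff_monomial_mul, if_neg]
  intro h
  have := h s
  simp [hd] at this

theorem homPart_X_mul (s : Fin n ⊕ Fin n) (m : ℤ) (u : etaCompletion K n) :
    homPart m (XC s * u) = MvPolynomial.X s * homPart (m - etaWeight n s) u := by
  classical
  ext d
  rw [coeff_homPart]
  change (if eta d = m then MvPowerSeries.coeff d (MvPowerSeries.X s * u.1) else 0) = _
  by_cases hd : d s = 0
  · rw [coeff_X_mul_eq_zero s d hd, ite_self, MvPolynomial.coeff_X_mul', if_neg (by simpa using hd)]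
  · obtain ⟨e, rfl⟩ : ∃ e, d = Finsupp.single s 1 + e :=
      ⟨d - Finsupp.single s 1,
        (add_tsub_cancel_of_le (by simpa using Nat.one_le_iff_ne_zero.mpr hd)).symm⟩
    rw [MvPolynomial.coeff_X_mul, coeff_homPart, MvPowerSeries.X_def,
      MvPowerSeries.coeff_add_monomial_mul, one_mul, eta_add, eta_single]
    exact if_congr (by omega) rfl rfl

theorem homPart_pderivC (s : Fin n ⊕ Fin n) (m : ℤ) (u : etaCompletion K n) :
    homPart m (pderivC s u) = MvPolynomial.pderiv s (homPart (m + etaWeight n s) u) := by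
  ext d
  rw [coeff_homPart, MvPolynomial.coeff_pderiv, coeff_homPart, coe_pderivC,
    MvPowerSeries.coeff_pderiv, eta_add, eta_single]
  by_cases h : eta d = m <;> simp [h]

/-- `Φ` commutes with the partial derivatives. -/
theorem Phi_pderivC (s : Fin n ⊕ Fin n) (u : etaCompletion K n) :
    Phi K n (pderivC s u) = pderivC s (Phi K n u) := by
  refine etaCompletion_ext fun m => ?_
  rw [homPart_Phi, homPart_pderivC, homPart_pderivC, homPart_Phi, PhiPoly_pderiv]

/-- `Φ` intertwines multiplication by a variable with the sum of that multiplication and the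
derivative in the conjugate variable. -/
theorem Phi_XC_mul [CharZero K] (s : Fin n ⊕ Fin n) (u : etaCompletion K n) :
    Phi K n (XC s * u) = XC s * Phi K n u + pderivC s.swap (Phi K n u) := by
  refine etaCompletion_ext fun m => ?_
  rw [homPart_Phi, homPart_X_mul, homPart_add, homPart_X_mul, homPart_pderivC, homPart_Phi,
    homPart_Phi, PhiPoly_X_mul, PhiPoly_pderiv, etaWeight_swap, sub_eq_add_neg]

/-- `Φ` respects the filtration by `η`-degree. -/
theorem coeff_Phi_eq_zero {u : etaCompletion K n} {d : (Fin n ⊕ Fin n) →₀ ℕ}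
    (h : ∀ e, eta e = eta d → MvPowerSeries.coeff e u.1 = 0) :
    MvPowerSeries.coeff d (Phi K n u).1 = 0 := by
  change (PhiPoly K n (homPart (eta d) u)).coeff d = 0
  have h0 : homPart (eta d) u = 0 := by
    ext e
    rw [coeff_homPart]
    split_ifs with he
    · simpa using h e he
    · simp
  simp [h0]

end PhaseSpace

/-! ### The formal exponential -/

namespace PhaseSpace

variable {K : Type*} [Field K] {n : ℕ}

section Exp

variable {τ : Type*} [CharZero K] {P : MvPowerSeries τ K}

/-- As `P` has no constant term, `P ^ k` has order at least `k`, and the exponential series may be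
truncated when a single coefficient is computed. -/
theorem coeff_exp_subst (hP : MvPowerSeries.constantCoeff P = 0) (d : τ →₀ ℕ) {M : ℕ}
    (hM : d.degree < M) :
    MvPowerSeries.coeff d ((PowerSeries.exp K).subst P) =
      ∑ k ∈ Finset.range M, (k ! : K)⁻¹ * MvPowerSeries.coeff d (P ^ k) := by
  rw [PowerSeries.coeff_subst (PowerSeries.HasSubst.of_constantCoeff_zero hP)]
  have hterm : ∀ k, PowerSeries.coeff k (PowerSeries.exp K) • MvPowerSeries.coeff d (P ^ k) =
      (k ! : K)⁻¹ * MvPowerSeries.coeff d (P ^ k) := by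
    intro k
    simp [PowerSeries.coeff_exp]
  rw [finsum_congr hterm]
  refine finsum_eq_sum_of_support_subset _ fun k hk => ?_
  by_contra h
  refine hk ?_
  beta_reduce
  simp only [Finset.coe_range, Set.mem_Iio, not_lt] at h
  rw [MvPowerSeries.coeff_of_lt_order, mul_zero]
  exact lt_of_lt_of_le (by exact_mod_cast lt_of_lt_of_le hM h)
    (MvPowerSeries.le_order_pow_of_constantCoeff_eq_zero k hP)

theorem coeff_exp_subst_eq_coeff_sum (hP : MvPowerSeries.constantCoeff P = 0) (d : τ →₀ ℕ) {M : ℕ}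
    (hM : d.degree < M) :
    MvPowerSeries.coeff d ((PowerSeries.exp K).subst P) =
      MvPowerSeries.coeff d (∑ k ∈ Finset.range M, (k ! : K)⁻¹ • P ^ k) := by
  rw [coeff_exp_subst hP d hM, map_sum]
  rfl

theorem constantCoeff_exp_subst (hP : MvPowerSeries.constantCoeff P = 0) :
    MvPowerSeries.coeff 0 ((PowerSeries.exp K).subst P) = 1 := by
  rw [coeff_exp_subst hP 0 (M := 1) (by simp)]
  simp

theorem pderiv_exp_subst (hP : MvPowerSeries.constantCoeff P = 0) (s : τ) :
    MvPowerSeries.pderiv K s ((PowerSeries.exp K).subst P) =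
      MvPowerSeries.pderiv K s P * (PowerSeries.exp K).subst P := by
  classical
  ext d
  have h1 : MvPowerSeries.pderiv K s (∑ k ∈ Finset.range (d.degree + 2), (k ! : K)⁻¹ • P ^ k) =
      MvPowerSeries.pderiv K s P * ∑ k ∈ Finset.range (d.degree + 1), (k ! : K)⁻¹ • P ^ k := by
    rw [Finset.sum_range_succ', map_add, map_sum, Finset.mul_sum]
    have h0 : MvPowerSeries.pderiv K s ((0 ! : K)⁻¹ • P ^ 0) = 0 := by simp
    rw [h0, add_zero]
    refine Finset.sum_congr rfl fun k _ => ?_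
    rw [Derivation.map_smul, MvPowerSeries.pderiv_pow, Nat.add_sub_cancel, mul_smul_comm,
      ← nsmul_eq_mul, smul_mul_assoc, ← Nat.cast_smul_eq_nsmul K, smul_smul, mul_comm (P ^ k)]
    congr 1
    have h1 : ((k + 1 : ℕ) : K) ≠ 0 := Nat.cast_ne_zero.mpr k.succ_ne_zero
    rw [Nat.factorial_succ, Nat.cast_mul, mul_inv, mul_right_comm, inv_mul_cancel₀ h1, one_mul]
  rw [MvPowerSeries.coeff_pderiv,
    coeff_exp_subst_eq_coeff_sum hP _ (M := d.degree + 2) (by simp), ← MvPowerSeries.coeff_pderiv,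
    h1, MvPowerSeries.coeff_mul, MvPowerSeries.coeff_mul]
  refine Finset.sum_congr rfl fun p hp => ?_
  rw [coeff_exp_subst_eq_coeff_sum hP p.2 (M := d.degree + 1)]
  rw [← Finset.HasAntidiagonal.mem_antidiagonal.mp hp, map_add]
  omega

end Exp

/-! ### Power series in `z` and the exponentials `e^{⟨ξ, H⟩}` -/

theorem coeff_inZ_embDomain (f : MvPowerSeries (Fin n) K) (e : Fin n →₀ ℕ) :
    MvPowerSeries.coeff (Finsupp.embDomain Function.Embedding.inr e) (inZ f) =
      MvPowerSeries.coeff e f :=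
  MvPowerSeries.coeff_embDomain_rename Function.Embedding.inr f e

theorem embDomain_inr_apply_inl (e : Fin n →₀ ℕ) (i : Fin n) :
    Finsupp.embDomain (Function.Embedding.inr : Fin n ↪ Fin n ⊕ Fin n) e (Sum.inl i) = 0 :=
  Finsupp.embDomain_of_notMem_range _ _ _ (by simp)

theorem embDomain_inr_apply_inr (e : Fin n →₀ ℕ) (i : Fin n) :
    Finsupp.embDomain (Function.Embedding.inr : Fin n ↪ Fin n ⊕ Fin n) e (Sum.inr i) = e i :=
  Finsupp.embDomain_apply_self Function.Embedding.inr e i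

theorem exists_embDomain_eq {d : (Fin n ⊕ Fin n) →₀ ℕ} (hd : ∀ i, d (Sum.inl i) = 0) :
    ∃ e, d = Finsupp.embDomain Function.Embedding.inr e := by
  refine ⟨Finsupp.equivFunOnFinite.symm fun i => d (Sum.inr i), ?_⟩
  ext s
  rcases s with i | i
  · rw [hd, embDomain_inr_apply_inl]
  · rw [embDomain_inr_apply_inr, Finsupp.equivFunOnFinite_symm_apply_apply]

theorem coeff_inZ_eq_zero (f : MvPowerSeries (Fin n) K) {d : (Fin n ⊕ Fin n) →₀ ℕ} {i : Fin n}
    (hd : d (Sum.inl i) ≠ 0) : MvPowerSeries.coeff d (inZ f) = 0 := by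
  refine MvPowerSeries.coeff_rename_eq_zero _ _ ?_
  rintro ⟨e, rfl⟩
  refine hd ?_
  rw [Finsupp.mapDomain_of_notMem_range]
  simp

theorem exists_of_coeff_inZ_ne_zero {f : MvPowerSeries (Fin n) K} {d : (Fin n ⊕ Fin n) →₀ ℕ}
    (hd : MvPowerSeries.coeff d (inZ f) ≠ 0) :
    ∃ e, d = Finsupp.embDomain Function.Embedding.inr e ∧ MvPowerSeries.coeff e f ≠ 0 := by
  obtain ⟨e, rfl⟩ := exists_embDomain_eq (d := d) fun i => by
    by_contra h
    exact hd (coeff_inZ_eq_zero f h)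
  exact ⟨e, rfl, by rwa [coeff_inZ_embDomain] at hd⟩

theorem inZ_add (f g : MvPowerSeries (Fin n) K) : inZ (f + g) = inZ f + inZ g := map_add _ f g

theorem inZ_mul (f g : MvPowerSeries (Fin n) K) : inZ (f * g) = inZ f * inZ g := map_mul _ f g

theorem inZ_X (i : Fin n) : inZ (MvPowerSeries.X i : MvPowerSeries (Fin n) K) =
    MvPowerSeries.X (Sum.inr i) := MvPowerSeries.rename_X _ i

theorem pderiv_inl_inZ (i : Fin n) (f : MvPowerSeries (Fin n) K) :
    MvPowerSeries.pderiv K (Sum.inl i) (inZ f) = 0 := by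
  ext d
  rw [MvPowerSeries.coeff_pderiv, coeff_inZ_eq_zero f (i := i) (by simp), zero_mul, map_zero]

theorem pderiv_inr_inZ (i : Fin n) (f : MvPowerSeries (Fin n) K) :
    MvPowerSeries.pderiv K (Sum.inr i) (inZ f) = inZ (MvPowerSeries.pderiv K i f) := by
  ext d
  by_cases hd : ∀ j, d (Sum.inl j) = 0
  · obtain ⟨e, rfl⟩ := exists_embDomain_eq hd
    have h : Finsupp.embDomain (Function.Embedding.inr : Fin n ↪ Fin n ⊕ Fin n) e +
        Finsupp.single (Sum.inr i) 1 =
        Finsupp.embDomain Function.Embedding.inr (e + Finsupp.single i 1) := by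
      rw [Finsupp.embDomain_add, Finsupp.embDomain_single]
      rfl
    rw [MvPowerSeries.coeff_pderiv, h, coeff_inZ_embDomain, coeff_inZ_embDomain,
      MvPowerSeries.coeff_pderiv, embDomain_inr_apply_inr]
  · push Not at hd
    obtain ⟨j, hj⟩ := hd
    rw [MvPowerSeries.coeff_pderiv, coeff_inZ_eq_zero _ (i := j) (by simpa using hj),
      coeff_inZ_eq_zero _ hj, zero_mul]

theorem constantCoeff_pairing (H : Fin n → MvPowerSeries (Fin n) K) :
    MvPowerSeries.constantCoeff (pairing H) = 0 := by
  simp [pairing]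

theorem pderiv_inl_pairing (H : Fin n → MvPowerSeries (Fin n) K) (i : Fin n) :
    MvPowerSeries.pderiv K (Sum.inl i) (pairing H) = inZ (H i) := by
  classical
  simp [pairing, Derivation.leibniz, pderiv_inl_inZ, MvPowerSeries.pderiv_X, Pi.single_apply]

theorem pderiv_inr_pairing (H : Fin n → MvPowerSeries (Fin n) K) (i : Fin n) :
    MvPowerSeries.pderiv K (Sum.inr i) (pairing H) =
      ∑ j, MvPowerSeries.X (Sum.inl j) * inZ (MvPowerSeries.pderiv K i (H j)) := by
  classical
  simp [pairing, Derivation.leibniz, pderiv_inr_inZ]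

theorem pderiv_inl_expPairing [CharZero K] (H : Fin n → MvPowerSeries (Fin n) K) (i : Fin n) :
    MvPowerSeries.pderiv K (Sum.inl i) (expPairing H) = inZ (H i) * expPairing H := by
  rw [expPairing, pderiv_exp_subst (constantCoeff_pairing H), pderiv_inl_pairing]

theorem pderiv_inr_expPairing [CharZero K] (H : Fin n → MvPowerSeries (Fin n) K) (i : Fin n) :
    MvPowerSeries.pderiv K (Sum.inr i) (expPairing H) =
      (∑ j, MvPowerSeries.X (Sum.inl j) * inZ (MvPowerSeries.pderiv K i (H j))) *
        expPairing H := by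
  rw [expPairing, pderiv_exp_subst (constantCoeff_pairing H), pderiv_inr_pairing]

theorem coeff_zero_expPairing [CharZero K] (H : Fin n → MvPowerSeries (Fin n) K) :
    MvPowerSeries.coeff 0 (expPairing H) = 1 :=
  constantCoeff_exp_subst (constantCoeff_pairing H)

/-- The power series in which every monomial `ξ^α z^β` satisfies `2 |α| ≤ |β|`. -/
noncomputable def tame (K : Type*) [Field K] (n : ℕ) :
    Subalgebra K (MvPowerSeries (Fin n ⊕ Fin n) K) where
  carrier := {u | ∀ d, MvPowerSeries.coeff d u ≠ 0 →
    2 * ∑ i, d (Sum.inl i) ≤ ∑ i, d (Sum.inr i)}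
  add_mem' := by
    rintro u v hu hv d hd
    by_cases h : MvPowerSeries.coeff d u = 0
    · exact hv d fun h' => hd (by rw [map_add, h, h', add_zero])
    · exact hu d h
  mul_mem' := by
    classical
    rintro u v hu hv d hd
    rw [MvPowerSeries.coeff_mul] at hd
    obtain ⟨p, hp, hne⟩ := Finset.exists_ne_zero_of_sum_ne_zero hd
    rw [← Finset.HasAntidiagonal.mem_antidiagonal.mp hp]
    have h1 := hu p.1 (left_ne_zero_of_mul hne)
    have h2 := hv p.2 (right_ne_zero_of_mul hne)
    simp only [Finsupp.add_apply, Finset.sum_add_distrib]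
    omega
  algebraMap_mem' := by
    classical
    intro r d hd
    have h : d = 0 := by
      by_contra h0
      exact hd (by simp [MvPowerSeries.algebraMap_apply, MvPowerSeries.coeff_C, h0])
    simp [h]

theorem tame_le_etaCompletion : tame K n ≤ etaCompletion K n := by
  intro u hu
  refine ⟨⟨-1, fun d hd => ?_⟩, fun m => ?_⟩
  · by_contra hne
    have h := hu d hne
    rw [eta_eq] at hd
    zify at h
    have h0 : (0 : ℤ) ≤ ∑ i, (d (Sum.inl i) : ℤ) := Finset.sum_nonneg fun i _ => by positivity
    linarith
  · refine (Finsupp.finite_of_degree_le (3 * m.toNat)).subset ?_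
    rintro d ⟨hd, hne⟩
    have h := hu d hne
    rw [eta_eq] at hd
    change d.degree ≤ _
    rw [Finsupp.degree_eq_sum, Fintype.sum_sum_type]
    push_cast [← Nat.cast_sum] at hd
    omega

theorem inZ_mem_tame (f : MvPowerSeries (Fin n) K) : inZ f ∈ tame K n := by
  intro d hd
  obtain ⟨e, rfl, -⟩ := exists_of_coeff_inZ_ne_zero hd
  simp

theorem pairing_mem_tame {H : Fin n → MvPowerSeries (Fin n) K} (hH : ∀ i, 2 ≤ (H i).order) :
    pairing H ∈ tame K n := by
  classical
  refine Subalgebra.sum_mem _ fun i _ => ?_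
  intro d hd
  by_cases h0 : d (Sum.inl i) = 0
  · exact absurd (coeff_X_mul_eq_zero _ d h0 _) hd
  obtain ⟨e, rfl⟩ : ∃ e, d = Finsupp.single (Sum.inl i) 1 + e :=
    ⟨d - Finsupp.single (Sum.inl i) 1,
      (add_tsub_cancel_of_le (by simpa using Nat.one_le_iff_ne_zero.mpr h0)).symm⟩
  rw [MvPowerSeries.X_def, MvPowerSeries.coeff_add_monomial_mul, one_mul] at hd
  obtain ⟨b, rfl, hb⟩ := exists_of_coeff_inZ_ne_zero hd
  have h2 : 2 ≤ b.degree := by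
    by_contra h
    exact hb (MvPowerSeries.coeff_of_lt_order
      (lt_of_lt_of_le (by exact_mod_cast not_le.mp h) (hH i)))
  rw [Finsupp.degree_eq_sum] at h2
  simpa [Finset.sum_add_distrib, embDomain_inr_apply_inl, embDomain_inr_apply_inr,
    Finsupp.single_apply] using h2

theorem expPairing_mem_tame [CharZero K] {H : Fin n → MvPowerSeries (Fin n) K}
    (hH : ∀ i, 2 ≤ (H i).order) : expPairing H ∈ tame K n := by
  intro d hd
  rw [expPairing, coeff_exp_subst_eq_coeff_sum (constantCoeff_pairing H) d d.degree.lt_succ_self]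
    at hd
  exact Subalgebra.sum_mem _ (fun k _ => Subalgebra.smul_mem _
    (Subalgebra.pow_mem _ (pairing_mem_tame hH) k) _) d hd

end PhaseSpace

/-! ### The transform of `u(z) e^{⟨ξ, H(z)⟩}` -/

namespace PhaseSpace

variable {K : Type*} [Field K] {n : ℕ}

/-- A power series in `z` as an element of the completion. -/
noncomputable def inZC (f : MvPowerSeries (Fin n) K) : etaCompletion K n :=
  ⟨inZ f, tame_le_etaCompletion (inZ_mem_tame f)⟩

theorem eta_embDomain (e : Fin n →₀ ℕ) :
    eta (Finsupp.embDomain (Function.Embedding.inr : Fin n ↪ Fin n ⊕ Fin n) e) =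
      (e.degree : ℤ) := by
  rw [eta_eq, Finsupp.degree_eq_sum]
  simp

/-- Multiplication by a series in `z` of order `m` raises the `η`-filtration by `m`. -/
theorem coeff_inZ_mul_eq_zero {r : MvPowerSeries (Fin n) K} {m : ℕ} (hr : (m : ℕ∞) ≤ r.order)
    {v : MvPowerSeries (Fin n ⊕ Fin n) K} (hv : ∀ d, eta d < 0 → MvPowerSeries.coeff d v = 0)
    {d : (Fin n ⊕ Fin n) →₀ ℕ} (hd : eta d < m) :
    MvPowerSeries.coeff d (inZ r * v) = 0 := by
  classical
  rw [MvPowerSeries.coeff_mul]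
  refine Finset.sum_eq_zero fun p hp => ?_
  by_contra hne
  obtain ⟨e, he, hre⟩ := exists_of_coeff_inZ_ne_zero (left_ne_zero_of_mul hne)
  have h1 : m ≤ e.degree := by
    by_contra h
    exact hre (MvPowerSeries.coeff_of_lt_order
      (lt_of_lt_of_le (by exact_mod_cast not_le.mp h) hr))
  have h2 : 0 ≤ eta p.2 := not_lt.mp fun h => right_ne_zero_of_mul hne (hv _ h)
  rw [← Finset.HasAntidiagonal.mem_antidiagonal.mp hp, eta_add, he, eta_embDomain] at hd
  omega

theorem coeff_eq_zero_of_mem_tame {u : MvPowerSeries (Fin n ⊕ Fin n) K} (hu : u ∈ tame K n)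
    {d : (Fin n ⊕ Fin n) →₀ ℕ} (hd : eta d < 0) : MvPowerSeries.coeff d u = 0 := by
  by_contra hne
  have h := hu d hne
  rw [eta_eq] at hd
  push_cast [← Nat.cast_sum] at hd
  omega

theorem two_le_order_sub_X {H : Fin n → MvPowerSeries (Fin n) K} (hH : ∀ i, 2 ≤ (H i).order)
    (i : Fin n) : 2 ≤ ((MvPowerSeries.X i - H i) - MvPowerSeries.X i).order := by
  rw [sub_sub_cancel_left, MvPowerSeries.order_neg]
  exact hH i

theorem constantCoeff_jacobian {H : Fin n → MvPowerSeries (Fin n) K}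
    (hH : ∀ i, 2 ≤ (H i).order) :
    MvPowerSeries.constantCoeff (jacobian fun i => MvPowerSeries.X i - H i) = 1 := by
  classical
  rw [jacobian, RingHom.map_det]
  convert Matrix.det_one (n := Fin n) (R := K) using 2
  ext i j
  have h : MvPowerSeries.coeff (0 + Finsupp.single j 1) (H i) = 0 :=
    MvPowerSeries.coeff_of_lt_order (lt_of_lt_of_le (by simp) (hH i))
  have h' : MvPowerSeries.constantCoeff (MvPowerSeries.pderiv K j (H i)) = 0 := by
    rw [← MvPowerSeries.coeff_zero_eq_constantCoeff_apply, MvPowerSeries.coeff_pderiv, h, zero_mul]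
  simp only [RingHom.mapMatrix_apply, Matrix.map_apply, Matrix.of_apply, map_sub, h', sub_zero,
    MvPowerSeries.pderiv_X, Pi.single_apply, Matrix.one_apply]
  split_ifs <;> simp

/-- A solution of `∂_{ξ_i} w = N_i(z) w` is determined by `w(0, z)`; when in addition every
`∂_{z_i} w` vanishes at `ξ = 0`, it is determined by `w(0, 0)`. -/
theorem eq_zero_of_pderiv [CharZero K] {N : Fin n → MvPowerSeries (Fin n) K}
    {w : MvPowerSeries (Fin n ⊕ Fin n) K}
    (h1 : ∀ i, MvPowerSeries.pderiv K (Sum.inl i) w = inZ (N i) * w)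
    (h2 : ∀ i d, (∀ j, d (Sum.inl j) = 0) →
      MvPowerSeries.coeff d (MvPowerSeries.pderiv K (Sum.inr i) w) = 0)
    (h0 : MvPowerSeries.coeff 0 w = 0) : w = 0 := by
  classical
  have hsub : ∀ {s : Fin n ⊕ Fin n} {d : (Fin n ⊕ Fin n) →₀ ℕ}, d s ≠ 0 →
      ∃ e, d = e + Finsupp.single s 1 := fun {s d} hd =>
    ⟨d - Finsupp.single s 1,
      (tsub_add_cancel_of_le (by simpa using Nat.one_le_iff_ne_zero.mpr hd)).symm⟩
  have hcast : ∀ k : ℕ, (k : K) + 1 ≠ 0 := fun k => by exact_mod_cast k.succ_ne_zero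
  have key : ∀ (m : ℕ) (d : (Fin n ⊕ Fin n) →₀ ℕ), ∑ i, d (Sum.inl i) = m →
      MvPowerSeries.coeff d w = 0 := by
    intro m
    induction m using Nat.strong_induction_on with
    | _ m ih =>
      intro d hd
      by_cases hξ : ∀ j, d (Sum.inl j) = 0
      · by_cases hz : ∀ j, d (Sum.inr j) = 0
        · have : d = 0 := by
            ext s
            rcases s with j | j
            exacts [hξ j, hz j]
          rw [this, h0]
        · push Not at hz
          obtain ⟨i, hi⟩ := hz
          obtain ⟨e, rfl⟩ := hsub hi
          have h := h2 i e fun j => by simpa using hξ j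
          rw [MvPowerSeries.coeff_pderiv] at h
          exact (mul_eq_zero.mp h).resolve_right (hcast _)
      · push Not at hξ
        obtain ⟨i, hi⟩ := hξ
        obtain ⟨e, rfl⟩ := hsub hi
        have hsum : ∑ j, e (Sum.inl j) + 1 = m := by
          rw [← hd]
          simp [Finset.sum_add_distrib, Finsupp.single_apply]
        have h := congrArg (MvPowerSeries.coeff e) (h1 i)
        have hr : MvPowerSeries.coeff e (inZ (N i) * w) = 0 := by
          rw [MvPowerSeries.coeff_mul]
          refine Finset.sum_eq_zero fun p hp => ?_
          rw [ih (∑ j, p.2 (Sum.inl j)) _ p.2 rfl, mul_zero]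
          rw [← hsum, ← Finset.HasAntidiagonal.mem_antidiagonal.mp hp]
          simp only [Finsupp.add_apply, Finset.sum_add_distrib]
          omega
        rw [hr, MvPowerSeries.coeff_pderiv] at h
        exact (mul_eq_zero.mp h).resolve_right (hcast _)
  ext d
  simpa using key _ d rfl

variable [CharZero K] {H : Fin n → MvPowerSeries (Fin n) K}

/-- The exponential `e^{⟨ξ, H(z)⟩}` as an element of the completion. -/
noncomputable def expC (hH : ∀ i, 2 ≤ (H i).order) : etaCompletion K n :=
  ⟨expPairing H, tame_le_etaCompletion (expPairing_mem_tame hH)⟩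

/-- The transform `Φ (u(z) e^{⟨ξ, H(z)⟩})`, as a linear map in the amplitude `u`. -/
noncomputable def phiExp (hH : ∀ i, 2 ≤ (H i).order) :
    MvPowerSeries (Fin n) K →ₗ[K] etaCompletion K n where
  toFun u := Phi K n (inZC u * expC hH)
  map_add' u v := by
    rw [← map_add, ← add_mul]
    congr 2
    exact Subtype.ext (inZ_add u v)
  map_smul' c u := by
    rw [RingHom.id_apply, ← map_smul, ← smul_mul_assoc]
    congr 2
    exact Subtype.ext (map_smul (MvPowerSeries.rename (R := K) Sum.inr) c u)

theorem phiExp_apply (hH : ∀ i, 2 ≤ (H i).order) (u : MvPowerSeries (Fin n) K) :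
    phiExp hH u = Phi K n (inZC u * expC hH) := rfl

theorem pderivC_inl_phiExp (hH : ∀ i, 2 ≤ (H i).order) (i : Fin n)
    (u : MvPowerSeries (Fin n) K) :
    pderivC (Sum.inl i) (phiExp hH u) = phiExp hH (H i * u) := by
  rw [phiExp_apply, phiExp_apply, ← Phi_pderivC]
  congr 1
  refine Subtype.ext ?_
  change MvPowerSeries.pderiv K (Sum.inl i) (inZ u * expPairing H) = inZ (H i * u) * expPairing H
  rw [Derivation.leibniz, pderiv_inl_inZ, pderiv_inl_expPairing, inZ_mul, smul_eq_mul, smul_zero,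
    add_zero]
  ring

/-- The transform turns multiplication by `F_i = z_i - H_i` into multiplication by `z_i`. -/
theorem phiExp_sub_mul (hH : ∀ i, 2 ≤ (H i).order) (i : Fin n) (u : MvPowerSeries (Fin n) K) :
    phiExp hH ((MvPowerSeries.X i - H i) * u) = XC (Sum.inr i) * phiExp hH u := by
  have h : phiExp hH (MvPowerSeries.X i * u) =
      XC (Sum.inr i) * phiExp hH u + pderivC (Sum.inl i) (phiExp hH u) := by
    rw [phiExp_apply, phiExp_apply, ← Sum.swap_inr, ← Phi_XC_mul, ← mul_assoc]
    congr 2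
    exact Subtype.ext (by
      change inZ _ = MvPowerSeries.X _ * inZ u
      rw [inZ_mul, inZ_X])
  rw [sub_mul, map_sub, h, pderivC_inl_phiExp, add_sub_cancel_right]

/-- The image under `Φ` of the product rule for `∂_{z_i} (u e^{⟨ξ, H⟩})`. -/
theorem pderivC_inr_phiExp (hH : ∀ i, 2 ≤ (H i).order) (i : Fin n)
    (u : MvPowerSeries (Fin n) K) :
    pderivC (Sum.inr i) (phiExp hH u) = phiExp hH (MvPowerSeries.pderiv K i u) +
      ∑ j, (XC (Sum.inl j) * phiExp hH (MvPowerSeries.pderiv K i (H j) * u) +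
        pderivC (Sum.inr j) (phiExp hH (MvPowerSeries.pderiv K i (H j) * u))) := by
  have h : pderivC (Sum.inr i) (inZC u * expC hH) =
      inZC (MvPowerSeries.pderiv K i u) * expC hH +
        ∑ j, XC (Sum.inl j) * (inZC (MvPowerSeries.pderiv K i (H j) * u) * expC hH) := by
    refine Subtype.ext ?_
    push_cast
    change MvPowerSeries.pderiv K (Sum.inr i) (inZ u * expPairing H) =
      inZ (MvPowerSeries.pderiv K i u) * expPairing H + ∑ j, MvPowerSeries.X (Sum.inl j) *
        (inZ (MvPowerSeries.pderiv K i (H j) * u) * expPairing H)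
    rw [Derivation.leibniz, pderiv_inr_inZ, pderiv_inr_expPairing, smul_eq_mul, smul_eq_mul,
      add_comm, mul_comm (expPairing H), Finset.sum_mul, Finset.mul_sum]
    congr 1
    refine Finset.sum_congr rfl fun j _ => ?_
    rw [inZ_mul]
    ring
  rw [phiExp_apply, ← Phi_pderivC, h, map_add, map_sum]
  congr 1
  refine Finset.sum_congr rfl fun j _ => ?_
  rw [Phi_XC_mul]
  rfl

/-- The differential equation in `z` satisfied by the transform of the Jacobian, a consequence of
the Piola identity. -/
theorem pderivC_inr_phiExp_jacobian (hH : ∀ i, 2 ≤ (H i).order)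
    (hJ : IsUnit (jacobian fun i => MvPowerSeries.X i - H i)) (k : Fin n) :
    XC (Sum.inl k) * phiExp hH (jacobian fun i => MvPowerSeries.X i - H i) +
      pderivC (Sum.inr k) (phiExp hH (jacobian fun i => MvPowerSeries.X i - H i)) =
    ∑ j, XC (Sum.inl j) * phiExp hH ((Matrix.of fun i j =>
      MvPowerSeries.pderiv K j (MvPowerSeries.X i - H i)).adjugate j k) := by
  classical
  set J : Matrix (Fin n) (Fin n) (MvPowerSeries (Fin n) K) :=
    Matrix.of fun i j => MvPowerSeries.pderiv K j (MvPowerSeries.X i - H i) with hJdef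
  have hdet : (jacobian fun i => MvPowerSeries.X i - H i) = J.det := rfl
  rw [hdet] at hJ ⊢
  have hPiola : ∑ i, MvPowerSeries.pderiv K i (J.adjugate i k) = 0 :=
    Derivation.sum_adjugate_eq_zero (fun i => MvPowerSeries.pderiv K i) pderiv_comm _ hJ k
  have hDH : ∀ j, ∑ i, MvPowerSeries.pderiv K i (H j) * J.adjugate i k =
      J.adjugate j k - if j = k then J.det else 0 := by
    intro j
    have h1 : ∀ i, MvPowerSeries.pderiv K i (H j) = (if i = j then 1 else 0) - J j i := by
      intro i
      simp [hJdef, MvPowerSeries.pderiv_X, Pi.single_apply, eq_comm]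
    have h2 : ∑ i, J j i * J.adjugate i k = if j = k then J.det else 0 := by
      rw [← Matrix.mul_apply, Matrix.mul_adjugate, Matrix.smul_apply, Matrix.one_apply]
      simp
    rw [← h2]
    simp_rw [h1, sub_mul, Finset.sum_sub_distrib]
    simp
  -- the product rule for `u = adj(J)_{ik}`, summed over `i`
  have hsum : ∑ i, pderivC (Sum.inr i) (phiExp hH (J.adjugate i k)) =
      ∑ j, (XC (Sum.inl j) * phiExp hH (J.adjugate j k - if j = k then J.det else 0) +
        pderivC (Sum.inr j) (phiExp hH (J.adjugate j k - if j = k then J.det else 0))) := by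
    rw [Finset.sum_congr rfl fun i _ => pderivC_inr_phiExp hH i (J.adjugate i k)]
    simp_rw [Finset.sum_add_distrib, ← map_sum]
    rw [hPiola, map_zero, zero_add, Finset.sum_comm, Finset.sum_comm (f := fun i j =>
      pderivC (Sum.inr j) (phiExp hH (MvPowerSeries.pderiv K i (H j) * J.adjugate i k)))]
    simp_rw [← Finset.mul_sum, ← map_sum, hDH]
  have hite : ∀ j, phiExp hH (if j = k then J.det else 0) =
      if j = k then phiExp hH J.det else 0 := fun j => by split_ifs <;> simp
  have hite' : ∀ j : Fin n, pderivC (Sum.inr j) (if j = k then phiExp hH J.det else 0) =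
      if j = k then pderivC (Sum.inr j) (phiExp hH J.det) else 0 := fun j => by
    split_ifs <;> simp
  simp only [map_sub, mul_sub, Finset.sum_add_distrib, Finset.sum_sub_distrib, hite, hite',
    mul_ite, mul_zero, Finset.sum_ite_eq', Finset.mem_univ, if_true] at hsum
  linear_combination hsum

/-- The transform is continuous: it maps the filtration by order to the `η`-filtration. -/
theorem coeff_phiExp_eq_zero (hH : ∀ i, 2 ≤ (H i).order) {u : MvPowerSeries (Fin n) K} {m : ℕ}
    (hu : (m : ℕ∞) ≤ u.order) {d : (Fin n ⊕ Fin n) →₀ ℕ} (hd : eta d < m) :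
    MvPowerSeries.coeff d (phiExp hH u).1 = 0 := by
  refine coeff_Phi_eq_zero fun e he => ?_
  exact coeff_inZ_mul_eq_zero hu
    (fun b hb => coeff_eq_zero_of_mem_tame (expPairing_mem_tame hH) hb) (he ▸ hd)

theorem phiExp_subst_mul_poly (hH : ∀ i, 2 ≤ (H i).order) (u : MvPowerSeries (Fin n) K)
    (p : MvPolynomial (Fin n) K) :
    phiExp hH (MvPowerSeries.subst (fun i => MvPowerSeries.X i - H i)
      (p : MvPowerSeries (Fin n) K) * u) = inZC (p : MvPowerSeries (Fin n) K) * phiExp hH u := by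
  have hs := MvPowerSeries.hasSubst_of_two_le_order_sub_X (two_le_order_sub_X hH)
  induction p using MvPolynomial.induction_on generalizing u with
  | C a =>
    have h : inZC (MvPowerSeries.C a : MvPowerSeries (Fin n) K) =
        algebraMap K (etaCompletion K n) a :=
      Subtype.ext (MvPowerSeries.rename_C _ a)
    rw [MvPolynomial.coe_C, MvPowerSeries.subst_C, h, ← MvPowerSeries.smul_eq_C_mul, map_smul,
      Algebra.smul_def]
  | add p q hp hq =>
    have h : inZC ((p : MvPowerSeries (Fin n) K) + (q : MvPowerSeries (Fin n) K)) =
        inZC (p : MvPowerSeries (Fin n) K) + inZC (q : MvPowerSeries (Fin n) K) :=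
      Subtype.ext (inZ_add _ _)
    rw [MvPolynomial.coe_add, MvPowerSeries.subst_add hs, add_mul, map_add, hp, hq, h, add_mul]
  | mul_X p i hp =>
    have h : inZC ((p : MvPowerSeries (Fin n) K) * MvPowerSeries.X i) =
        inZC (p : MvPowerSeries (Fin n) K) * XC (Sum.inr i) :=
      Subtype.ext ((inZ_mul _ _).trans (by rw [inZ_X]; rfl))
    rw [MvPolynomial.coe_mul, MvPolynomial.coe_X, MvPowerSeries.subst_mul hs,
      MvPowerSeries.subst_X hs, mul_assoc, hp, phiExp_sub_mul, h, mul_assoc]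

/-- The transform turns multiplication by `p(F(z))` into multiplication by `p(z)`. -/
theorem phiExp_subst_mul (hH : ∀ i, 2 ≤ (H i).order) (u p : MvPowerSeries (Fin n) K) :
    phiExp hH (MvPowerSeries.subst (fun i => MvPowerSeries.X i - H i) p * u) =
      inZC p * phiExp hH u := by
  have hF := two_le_order_sub_X hH
  have hs := MvPowerSeries.hasSubst_of_two_le_order_sub_X hF
  refine Subtype.ext ?_
  ext d
  -- Modulo series of order `m`, which do not contribute at `d`, the series `p` is a polynomial.
  obtain ⟨m, hm⟩ : ∃ m : ℕ, eta d < m := ⟨(eta d).toNat + 1, by omega⟩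
  obtain ⟨p₀, r, rfl, hr⟩ : ∃ (p₀ : MvPolynomial (Fin n) K) (r : MvPowerSeries (Fin n) K),
      p = p₀ + r ∧ (m : ℕ∞) ≤ r.order := by
    refine ⟨MvPowerSeries.truncTotal m p, p - MvPowerSeries.truncTotal m p, by ring, ?_⟩
    refine MvPowerSeries.nat_le_order fun e he => ?_
    rw [map_sub, MvPolynomial.coeff_coe, MvPowerSeries.coeff_truncTotal p he, sub_self]
  have h1 : MvPowerSeries.coeff d (phiExp hH
      (MvPowerSeries.subst (fun i => MvPowerSeries.X i - H i) r * u)).1 = 0 := by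
    refine coeff_phiExp_eq_zero hH (m := m) ?_ hm
    refine le_trans ?_ MvPowerSeries.le_order_mul
    exact le_add_right (MvPowerSeries.le_order_subst_of_le_order hF hr)
  have h2 : MvPowerSeries.coeff d (inZC r * phiExp hH u).1 = 0 :=
    coeff_inZ_mul_eq_zero hr (fun b hb => coeff_phiExp_eq_zero hH (m := 0) (by simp) hb) hm
  have h3 : inZC ((p₀ : MvPowerSeries (Fin n) K) + r) = inZC (p₀ : MvPowerSeries (Fin n) K) +
      inZC r := Subtype.ext (inZ_add _ _)
  rw [MvPowerSeries.subst_add hs, add_mul, map_add, phiExp_subst_mul_poly, h3, add_mul]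
  change _ + MvPowerSeries.coeff d (phiExp hH
      (MvPowerSeries.subst (fun i => MvPowerSeries.X i - H i) r * u)).1 =
    _ + MvPowerSeries.coeff d (inZC r * phiExp hH u).1
  rw [h1, h2]

/-- The constant term of the transform of a series in `z`: only the constant term of
`u(z) e^{⟨ξ, H(z)⟩}` has `η`-degree `0`. -/
theorem coeff_zero_phiExp (hH : ∀ i, 2 ≤ (H i).order) (u : MvPowerSeries (Fin n) K) :
    MvPowerSeries.coeff 0 (phiExp hH u).1 = MvPowerSeries.constantCoeff u := by
  classical
  have htame : inZ u * expPairing H ∈ tame K n :=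
    Subalgebra.mul_mem _ (inZ_mem_tame u) (expPairing_mem_tame hH)
  have hpart : homPart 0 (inZC u * expC hH) = MvPowerSeries.constantCoeff u • 1 := by
    ext d
    rw [coeff_homPart, MvPolynomial.coeff_smul, MvPolynomial.coeff_one]
    change (if eta d = 0 then MvPowerSeries.coeff d (inZ u * expPairing H) else 0) = _
    by_cases hd0 : d = 0
    · subst hd0
      have h := coeff_inZ_embDomain u 0
      rw [Finsupp.embDomain_zero] at h
      have hE := coeff_zero_expPairing H
      rw [MvPowerSeries.coeff_zero_eq_constantCoeff] at h hE ⊢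
      rw [map_mul, h, hE]
      simp [eta]
    · rw [if_neg (Ne.symm hd0), smul_zero]
      split_ifs with hd
      · by_contra hne
        have h := htame d hne
        rw [eta_eq] at hd
        push_cast [← Nat.cast_sum] at hd
        have h1 : ∑ i, d (Sum.inl i) = 0 := by omega
        have h2 : ∑ i, d (Sum.inr i) = 0 := by omega
        rw [Finset.sum_eq_zero_iff] at h1 h2
        refine hd0 (Finsupp.ext fun s => ?_)
        rcases s with j | j
        exacts [h1 j (Finset.mem_univ _), h2 j (Finset.mem_univ _)]
      · rfl
  have h0 : eta (0 : (Fin n ⊕ Fin n) →₀ ℕ) = 0 := by simp [eta]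
  change (PhiPoly K n (homPart (eta 0) (inZC u * expC hH))).coeff 0 = _
  rw [h0, hpart, map_smul, PhiPoly_one]
  simp

/-- The transform of the Jacobian is the exponential attached to the inverse map. -/
theorem phiExp_jacobian (hH : ∀ i, 2 ≤ (H i).order) {N : Fin n → MvPowerSeries (Fin n) K}
    (hN : ∀ i, H i = MvPowerSeries.subst (fun i => MvPowerSeries.X i - H i) (N i)) :
    (phiExp hH (jacobian fun i => MvPowerSeries.X i - H i)).1 = expPairing N := by
  have hJ1 := constantCoeff_jacobian hH
  set JF := jacobian fun i => MvPowerSeries.X i - H i with hJF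
  have hJ : IsUnit JF := by
    rw [MvPowerSeries.isUnit_iff_constantCoeff, hJ1]
    exact isUnit_one
  rw [← sub_eq_zero]
  refine eq_zero_of_pderiv (N := N) (fun i => ?_) (fun i d hd => ?_) ?_
  · have h1 : MvPowerSeries.pderiv K (Sum.inl i) (phiExp hH JF).1 =
        inZ (N i) * (phiExp hH JF).1 := by
      have h := pderivC_inl_phiExp hH i JF
      rw [congrArg (· * JF) (hN i), phiExp_subst_mul] at h
      exact congrArg Subtype.val h
    rw [map_sub, h1, pderiv_inl_expPairing, mul_sub]
  · have hX : ∀ (j : Fin n) (f : MvPowerSeries (Fin n ⊕ Fin n) K),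
        MvPowerSeries.coeff d (MvPowerSeries.X (Sum.inl j) * f) = 0 :=
      fun j f => coeff_X_mul_eq_zero _ d (hd j) f
    have h1 := congrArg (fun v : etaCompletion K n => MvPowerSeries.coeff d v.1)
      (pderivC_inr_phiExp_jacobian hH hJ i)
    push_cast at h1
    simp only [coe_XC, map_add, map_sum, hX, Finset.sum_const_zero, zero_add] at h1
    rw [map_sub, map_sub, pderiv_inr_expPairing, Finset.sum_mul, map_sum]
    simp_rw [mul_assoc, hX, Finset.sum_const_zero, sub_zero]
    exact h1
  · rw [map_sub, coeff_zero_phiExp, hJ1, coeff_zero_expPairing, sub_self]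

end PhaseSpace

/-! ### The inversion formula -/

open PhaseSpace in
theorem mainTheorem2 {K : Type*} [Field K] [CharZero K] (n : ℕ)
    (H : Fin n → MvPowerSeries (Fin n) K) (hH : ∀ i, 2 ≤ (H i).order) :
    (∃! N : Fin n → MvPowerSeries (Fin n) K,
      PhaseSpace.IsFormalInverse (fun i => MvPowerSeries.X i - H i)
        (fun i => MvPowerSeries.X i + N i)) ∧
    ∀ N : Fin n → MvPowerSeries (Fin n) K,
      PhaseSpace.IsFormalInverse (fun i => MvPowerSeries.X i - H i)
        (fun i => MvPowerSeries.X i + N i) →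
      (∀ i, 2 ≤ (N i).order) ∧
      ∀ q : MvPowerSeries (Fin n) K,
        ∃ (hL : PhaseSpace.inZ q *
              PhaseSpace.inZ (PhaseSpace.jacobian fun i => MvPowerSeries.X i - H i) *
              PhaseSpace.expPairing H ∈ PhaseSpace.etaCompletion K n)
          (hR : PhaseSpace.inZ (MvPowerSeries.subst (fun i => MvPowerSeries.X i + N i) q) *
              PhaseSpace.expPairing N ∈ PhaseSpace.etaCompletion K n),
          PhaseSpace.Phi K n ⟨_, hL⟩ = ⟨_, hR⟩ := by
  have hF := two_le_order_sub_X hH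
  have hs := MvPowerSeries.hasSubst_of_two_le_order_sub_X hF
  obtain ⟨G, hG, hGF, hFG⟩ := MvPowerSeries.exists_inverse hF
  have hsG := MvPowerSeries.hasSubst_of_two_le_order_sub_X hG
  have hconst : ∀ {A : Fin n → MvPowerSeries (Fin n) K},
      (∀ i, 2 ≤ (A i - MvPowerSeries.X i).order) → ∀ i, MvPowerSeries.constantCoeff (A i) = 0 := by
    intro A hA i
    have h : MvPowerSeries.coeff 0 (A i - MvPowerSeries.X i) = 0 :=
      MvPowerSeries.coeff_of_lt_order (lt_of_lt_of_le (by simp) (hA i))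
    simpa using h
  have huniq : ∀ N : Fin n → MvPowerSeries (Fin n) K,
      IsFormalInverse (fun i => MvPowerSeries.X i - H i) (fun i => MvPowerSeries.X i + N i) →
      N = fun i => G i - MvPowerSeries.X i := by
    rintro N ⟨-, -, -, hN⟩
    have h := MvPowerSeries.inverse_unique hs hsG hFG hN
    funext i
    rw [← congrFun h i]
    ring
  have hXG : (fun i => MvPowerSeries.X i + (G i - MvPowerSeries.X i)) = G := by
    funext i
    ring
  refine ⟨⟨fun i => G i - MvPowerSeries.X i, ?_, huniq⟩, fun N hN => ?_⟩
  · beta_reduce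
    rw [hXG]
    exact ⟨hconst hF, hconst hG, hFG, hGF⟩
  · obtain rfl := huniq N hN
    refine ⟨hG, fun q => ?_⟩
    rw [hXG]
    refine ⟨tame_le_etaCompletion (mul_mem (mul_mem (inZ_mem_tame _) (inZ_mem_tame _))
      (expPairing_mem_tame hH)), tame_le_etaCompletion (mul_mem (inZ_mem_tame _)
      (expPairing_mem_tame hG)), ?_⟩
    -- `N = H ∘ G`, in the form `H = N ∘ F`
    have hHN : ∀ i, H i = MvPowerSeries.subst (fun i => MvPowerSeries.X i - H i)
        (G i - MvPowerSeries.X i) := by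
      intro i
      rw [MvPowerSeries.subst_sub hs, hGF, MvPowerSeries.subst_X hs, sub_sub_cancel]
    have hq : MvPowerSeries.subst (fun i => MvPowerSeries.X i - H i) (MvPowerSeries.subst G q) =
        q := by
      rw [MvPowerSeries.subst_comp_subst_apply hsG hs, funext hGF, MvPowerSeries.subst_self]
      rfl
    have h := phiExp_subst_mul hH (jacobian fun i => MvPowerSeries.X i - H i)
      (MvPowerSeries.subst G q)
    rw [hq, phiExp_apply] at h
    refine Subtype.ext ?_
    change _ = inZ (MvPowerSeries.subst G q) * expPairing fun i => G i - MvPowerSeries.X i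
    rw [← phiExp_jacobian hH hHN]
    refine Eq.trans ?_ (congrArg Subtype.val h)
    congr 2
    exact Subtype.ext (congrArg (· * expPairing H) (inZ_mul _ _).symm)
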